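/- Let $G=(V,E)$ be a triangulated Laman graph on $n\ge 2$ vertices: it is the last graph of a Henneberg sequence $G(1),\dots,G(n)$, where $G(1)$ is a single vertex, $G(2)$ is obtained by linking a new vertex to it by an edge, and, for $l\ge 3$, $G(l)$ is obtained from $G(l-1)$ by linking a new vertex, by two new edges, to two adjacent vertices of $G(l-1)$. For every edge $(i,j)\in E$ let $\bar d_{ij}=\bar d_{ji}$ be a real number (the target distance) and let $u_{ij}=u_{ji}$ be a control law such that $u_{ij}(\cdot,\bar d_{ij})$ is continuously differentiable on $(0,\infty)$. On $P_G=\{p=(x_v)_{v\in V}\in(\mathbb R^2)^V : x_i\ne x_j \text{ for all } (i,j)\in E\}$ consider the potential $$\Phi(p)=\sum_{(i,j)\in E}\int_1^{\|x_i-x_j\|} s\,u_{ij}(s,\bar d_{ij})\,ds .$$ For a subgraph $G'=(V',E')$ of $G$, the potential induced by $G'$ is given by the same formula on $P_{G'}\subset(\mathbb R^2)^{V'}$, with the sum over $E'$. The group $\mathrm{SE}(2)$ acts on configurations by $(\theta,v)\cdot(x_i)_i=(\theta x_i+v)_i$, and $O_p$ denotes the orbit of $p$. If $p$ is a critical point of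 the potential, the critical orbit $O_p$ is called nondegenerate if the Hessian $H_p$ of the potential at $p$ has exactly three zero eigenvalues (counted with multiplicity), and exponentially stable if moreover all the other eigenvalues of $H_p$ are positive (these properties do not depend on the point chosen in the orbit). For $p\in P_G$, the independent partition of $E$ for $(G,p)$ is defined along a Henneberg sequence of $G$: the edge set of $G(2)$ is partitioned trivially; when a new vertex $k$ is linked to the adjacent vertices $i,j$, then, if $x_i,x_j,x_k$ are aligned, the edges $(i,k),(j,k)$ are added to the subset that contains $(i,j)$; if they are not aligned, the two singletons $\{(i,k)\}$ and $\{(j,k)\}$ are added to the partition. Let $p\in P_G$ be a critical point of $\Phi$ and let $E=E_1\sqcup\dots\sqcup E_m$ be an independent partition for $(G,p)$ (obtained along any Henneberg sequence of $G$). Let $G_i=(V_i,E_i)$, where $V_i$ is the set of vertices incident to the edges in $E_i$, let $p_i=p|_{V_i}$, and let $\Phi_i$ be the potential induced by $G_i$. Then each $p_i$ is a critical point of $\Phi_i$, so that $O_{p_i}$ is a critical orbit, and, with nondegeneracy and stability of $O_{p_i}$ understood with respect to $\Phi_i$: 1. the critical orbit $O_p$ is nondegenerate if and only if each $O_{p_i}$,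 $1\le i\le m$, is nondegenerate; 2. the critical orbit $O_p$ is exponentially stable if and only if each $O_{p_i}$, $1\le i\le m$, is exponentially stable. -/

import Mathlib

open Set
open scoped Gradient

noncomputable section

/-- Configurations `p = (x_v)_{v ∈ V}` of agents in the plane: the Euclidean space `ℝ^{2|V|}`, with
`p v = x_v ∈ ℝ²`. -/
abbrev Config (V : Type*) : Type _ := PiLp 2 (fun _ : V => EuclideanSpace ℝ (Fin 2))

/-- The configuration space `P_G`: adjacent vertices have distinct positions. -/
def configSpace {V : Type*} (G : SimpleGraph V) : Set (Config V) :=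
  {p | ∀ i j, G.Adj i j → p i ≠ p j}

/-- The distance `‖x_i - x_j‖` of the two endpoints of the unordered pair `e = s(i, j)`. -/
def pairDist {V : Type*} (p : Config V) (e : Sym2 V) : ℝ :=
  Sym2.lift ⟨fun i j => ‖p i - p j‖, fun i j => norm_sub_rev (p i) (p j)⟩ e

open Classical in
/-- The potential `Φ(p) = ∑_{(i,j) ∈ E} ∫_1^{‖x_i - x_j‖} s u_{ij}(s, d̄_{ij}) ds` of the formation
system induced by `G`, with control laws `u` and target distances `dbar` (both indexed by
unordered pairs).  Only its restriction to the open set `configSpace G` is used. -/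
def potential {V : Type*} [Fintype V] (G : SimpleGraph V) (u : Sym2 V → ℝ → ℝ → ℝ)
    (dbar : Sym2 V → ℝ) (p : Config V) : ℝ :=
  ∑ e ∈ G.edgeFinset, ∫ s in (1 : ℝ)..(pairDist p e), s * u e s (dbar e)

/-- The orbit `O_p` of `p` under `SE(2)`, where `(θ, v)` acts by `x_i ↦ θ x_i + v`. -/
def orbitSE2 {V : Type*} (p : Config V) : Set (Config V) :=
  {q | ∃ θ ∈ Matrix.specialOrthogonalGroup (Fin 2) ℝ, ∃ v : EuclideanSpace ℝ (Fin 2),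
    ∀ i, q i = Matrix.toEuclideanLin θ (p i) + v}

/-- `p` is a critical point of `Φ`: the gradient of `Φ` at `p` (exists and) vanishes. -/
def IsCriticalPt {V : Type*} [Fintype V] (Φ : Config V → ℝ) (p : Config V) : Prop :=
  HasGradientAt Φ 0 p

/-- The Hessian `H_p = ∂²Φ/∂p²`, as the derivative of the gradient, a linear operator on
`ℝ^{2|V|}`. -/
def hessian {V : Type*} [Fintype V] (Φ : Config V → ℝ) (p : Config V) :
    Config V →ₗ[ℝ] Config V :=
  (fderiv ℝ (fun q => ∇ Φ q) p : Config V →L[ℝ] Config V)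

/-- The eigenvalues of the Hessian of `Φ` at `p`, listed with multiplicity. -/
def hessianEigenvalues {V : Type*} [Fintype V] (Φ : Config V → ℝ) (p : Config V) : Multiset ℝ :=
  (hessian Φ p).charpoly.roots

/-- `O` consists of critical points of `Φ`. -/
def IsCriticalOrbit {V : Type*} [Fintype V] (Φ : Config V → ℝ) (O : Set (Config V)) : Prop :=
  ∀ q ∈ O, IsCriticalPt Φ q

/-- A critical orbit is nondegenerate if the Hessian has exactly three zero eigenvalues. -/
def IsNondegenerateOrbit {V : Type*} [Fintype V] (Φ : Config V → ℝ) (O : Set (Config V)) : Prop :=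
  IsCriticalOrbit Φ O ∧ ∀ q ∈ O, (hessianEigenvalues Φ q).count 0 = 3

/-- A critical orbit is exponentially stable if the Hessian has exactly three zero eigenvalues and
all its other eigenvalues are positive. -/
def IsExpStableOrbit {V : Type*} [Fintype V] (Φ : Config V → ℝ) (O : Set (Config V)) : Prop :=
  IsNondegenerateOrbit Φ O ∧ ∀ q ∈ O, ∀ c ∈ hessianEigenvalues Φ q, c ≠ 0 → 0 < c

/-- The graphs `(W, E)`, with vertex set `W` and edge set `E`, that occur in some Henneberg
sequence in which every new vertex (after the second) is linked to two adjacent vertices. -/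
inductive HennebergStage {V : Type*} : Set V → Set (Sym2 V) → Prop
  | single (a : V) : HennebergStage {a} ∅
  | link (a b : V) (hab : a ≠ b) : HennebergStage {a, b} {s(a, b)}
  | add {W : Set V} {E : Set (Sym2 V)} (h : HennebergStage W E) {i j k : V}
      (hij : s(i, j) ∈ E) (hk : k ∉ W) :
      HennebergStage (insert k W) (E ∪ {s(i, k), s(j, k)})

/-- Triangulated Laman graphs. -/
def IsTriangulatedLaman {V : Type*} (G : SimpleGraph V) : Prop :=
  HennebergStage Set.univ G.edgeSet

/-- `IndepPartitionStage p W E P`: following some Henneberg sequence up to the graph `(W, E)`, the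
recursive construction of the independent partition for the positions `p` yields the partition
`P` of `E`. -/
inductive IndepPartitionStage {V : Type*} (p : Config V) :
    Set V → Set (Sym2 V) → Set (Set (Sym2 V)) → Prop
  | init (a b : V) (hab : a ≠ b) : IndepPartitionStage p {a, b} {s(a, b)} {{s(a, b)}}
  | aligned {W : Set V} {E : Set (Sym2 V)} {P : Set (Set (Sym2 V))}
      (h : IndepPartitionStage p W E P) {i j k : V} {C : Set (Sym2 V)}
      (hC : C ∈ P) (hij : s(i, j) ∈ C) (hk : k ∉ W)
      (hcol : Collinear ℝ {p i, p j, p k}) :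
      IndepPartitionStage p (insert k W) (E ∪ {s(i, k), s(j, k)})
        (insert (C ∪ {s(i, k), s(j, k)}) (P \ {C}))
  | notAligned {W : Set V} {E : Set (Sym2 V)} {P : Set (Set (Sym2 V))}
      (h : IndepPartitionStage p W E P) {i j k : V}
      (hij : s(i, j) ∈ E) (hk : k ∉ W)
      (hcol : ¬ Collinear ℝ {p i, p j, p k}) :
      IndepPartitionStage p (insert k W) (E ∪ {s(i, k), s(j, k)})
        (P ∪ {{s(i, k)}, {s(j, k)}})

/-- `P` is an independent partition for the framework `(G, p)`. -/
def IsIndependentPartition {V : Type*} (G : SimpleGraph V) (p : Config V)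
    (P : Set (Set (Sym2 V))) : Prop :=
  IndepPartitionStage p Set.univ G.edgeSet P

/-- The set `V_i` of vertices incident to the edges in `E_i`. -/
def incidentVerts {V : Type*} (E : Set (Sym2 V)) : Set V := {v | ∃ e ∈ E, v ∈ e}

instance incidentVertsFintype {V : Type*} [Fintype V] (E : Set (Sym2 V)) :
    Fintype (incidentVerts E) := Fintype.ofFinite _

/-- The graph `G_i = (V_i, E_i)`. -/
def partGraph {V : Type*} (E : Set (Sym2 V)) : SimpleGraph (incidentVerts E) :=
  (SimpleGraph.fromEdgeSet E).induce (incidentVerts E)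

/-- The sub-configuration `p_i` of `p` induced by `G_i`. -/
def partConfig {V : Type*} (p : Config V) (E : Set (Sym2 V)) : Config (incidentVerts E) :=
  WithLp.toLp 2 (fun v => p v.1)

/-- The potential `Φ_i` of the subsystem induced by `G_i`. -/
def partPotential {V : Type*} [Fintype V] (u : Sym2 V → ℝ → ℝ → ℝ) (dbar : Sym2 V → ℝ)
    (E : Set (Sym2 V)) : Config (incidentVerts E) → ℝ :=
  potential (partGraph E) (fun e => u (e.map Subtype.val)) (fun e => dbar (e.map Subtype.val))

end

/-! Write `ω e = u e (d_e)` and `c e = u e' (d_e) / d_e` for the current edge lengths `d_e`. The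
gradient of the potential is a sum of edge forces with coefficients `ω`, so a critical point is a
framework for which `ω` is an equilibrium stress. The Hessian is the bilinear form `stiffnessForm`,
a sum of one term per edge, hence the sum of the forms of the pieces of any partition of the edges.
At an equilibrium, infinitesimal rigid motions lie in its kernel.

The independent partition makes this sum a direct one modulo rigid motions. Three inductions along
the Henneberg sequence show it. The stress balances on each piece separately
(`IndepPartitionStage.isStress`): at a non-aligned vertex both new stresses vanish, while an aligned
pair acts like extra stress on the edge it is attached to. A motion rigid on each piece is rigid
globally (`IndepPartitionStage.rigidOn`). Arbitrary motions of the pieces can be glued after rigid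
corrections (`IndepPartitionStage.exists_glue`).

So motions modulo rigid ones are the direct sum of those of the pieces, and the second variation is
block diagonal. Three zero eigenvalues mean that the kernel contains only rigid motions, and
stability adds semidefiniteness; both are checked block by block. Invariance under `SE(2)` reduces
statements on orbits to statements at one point. -/

noncomputable section

/-! ### First derivatives of distances and potentials -/

/-- The relative position `v ↦ v i - v j`. -/
def relPos {V : Type*} [Fintype V] (i j : V) : Config V →L[ℝ] EuclideanSpace ℝ (Fin 2) :=
  (PiLp.proj 2 (fun _ : V => EuclideanSpace ℝ (Fin 2)) i : Config V →L[ℝ] _) -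
    (PiLp.proj 2 (fun _ : V => EuclideanSpace ℝ (Fin 2)) j : Config V →L[ℝ] _)

theorem relPos_apply {V : Type*} [Fintype V] (i j : V) (v : Config V) :
    relPos i j v = v i - v j := rfl

/-- The symmetric bilinear form `(v, w) ↦ ⟪v i - v j, w i - w j⟫` attached to the pair `s(i, j)`. -/
def edgeForm {V : Type*} [Fintype V] (e : Sym2 V) : Config V →L[ℝ] Config V →L[ℝ] ℝ :=
  Sym2.lift ⟨fun i j => (innerSL ℝ).bilinearComp (relPos i j) (relPos i j), fun i j => by
    ext v w
    simp only [ContinuousLinearMap.bilinearComp_apply, relPos_apply, innerSL_apply_apply]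
    rw [← neg_sub (v j), ← neg_sub (w j), inner_neg_neg]⟩ e

@[simp] theorem edgeForm_mk {V : Type*} [Fintype V] (i j : V) (v w : Config V) :
    edgeForm s(i, j) v w = inner ℝ (v i - v j) (w i - w j) := rfl

@[simp] theorem pairDist_mk {V : Type*} (p : Config V) (i j : V) :
    pairDist p s(i, j) = ‖p i - p j‖ := rfl

theorem edgeForm_symm {V : Type*} [Fintype V] (e : Sym2 V) (v w : Config V) :
    edgeForm e v w = edgeForm e w v := by
  induction e with | _ i j => simp [real_inner_comm]

theorem pairDist_pos {V : Type*} {G : SimpleGraph V} {q : Config V} (hq : q ∈ configSpace G)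
    {e : Sym2 V} (he : e ∈ G.edgeSet) : 0 < pairDist q e := by
  induction e with | _ i j => simpa [sub_eq_zero] using hq i j he

theorem hasFDerivAt_pairDist {V : Type*} [Fintype V] {q : Config V} {e : Sym2 V}
    (he : 0 < pairDist q e) :
    HasFDerivAt (fun p => pairDist p e) ((pairDist q e)⁻¹ • edgeForm e q) q := by
  induction e with | _ i j =>
  simp only [pairDist_mk] at he ⊢
  have h := ((relPos i j).hasFDerivAt (x := q)).norm_sq.sqrt (by simpa [relPos_apply] using he.ne')
  simp only [Real.sqrt_sq (norm_nonneg _), relPos_apply] at h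
  refine h.congr_fderiv ?_
  ext w
  simp only [smul_apply, ContinuousLinearMap.comp_apply, relPos_apply, innerSL_apply_apply,
    edgeForm_mk, smul_eq_mul, nsmul_eq_mul, Nat.cast_ofNat]
  field_simp

/-- The factor `s` of the integrand cancels the inverse distance in the derivative of `pairDist`.
Continuity on `(0, ∞)` suffices because the interval between `1` and a positive distance stays
there. -/
theorem hasFDerivAt_edgePotential {V : Type*} [Fintype V] {f : ℝ → ℝ} (hf : ContinuousOn f (Ioi 0))
    {q : Config V} {e : Sym2 V} (he : 0 < pairDist q e) :
    HasFDerivAt (fun p => ∫ s in (1 : ℝ)..(pairDist p e), s * f s)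
      (f (pairDist q e) • edgeForm e q) q := by
  have hc : ContinuousOn (fun s => s * f s) (Ioi 0) := continuousOn_id.mul hf
  have hsub : uIcc 1 (pairDist q e) ⊆ Ioi 0 := fun x hx =>
    lt_of_lt_of_le (lt_min one_pos he) hx.1
  have h1 : HasDerivAt (fun d => ∫ s in (1 : ℝ)..d, s * f s) (pairDist q e * f (pairDist q e))
      (pairDist q e) := by
    refine intervalIntegral.integral_hasDerivAt_right (hc.mono hsub).intervalIntegrable ?_
      (hc.continuousAt (Ioi_mem_nhds he))
    exact hc.stronglyMeasurableAtFilter isOpen_Ioi _ he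
  refine (h1.comp_hasFDerivAt q (hasFDerivAt_pairDist he)).congr_fderiv ?_
  ext w
  simp only [smul_apply, smul_eq_mul]
  field_simp

theorem hasGradientAt_zero_iff {F : Type*} [NormedAddCommGroup F] [InnerProductSpace ℝ F]
    [CompleteSpace F] {Φ : F → ℝ} {D : F →L[ℝ] ℝ} {q : F} (h : HasFDerivAt Φ D q) :
    HasGradientAt Φ 0 q ↔ ∀ w, D w = 0 := by
  rw [hasGradientAt_iff_hasFDerivAt, map_zero]
  refine ⟨fun h0 w => by rw [h.unique h0]; rfl, fun h0 => ?_⟩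
  rwa [show D = 0 from ContinuousLinearMap.ext h0] at h

/-- The gradient is the Riesz image of the differential, and the Riesz map is linear.
Differentiability near `q` is enough, as the potential is controlled only on the open set
`configSpace G`. -/
theorem inner_fderiv_gradient {F : Type*} [NormedAddCommGroup F] [InnerProductSpace ℝ F]
    [CompleteSpace F] {Φ : F → ℝ} {D : F → F →L[ℝ] ℝ} {D' : F →L[ℝ] F →L[ℝ] ℝ} {q : F}
    (h : ∀ᶠ p in nhds q, HasFDerivAt Φ (D p) p) (hD : HasFDerivAt D D' q) (v w : F) :
    inner ℝ (fderiv ℝ (fun p => ∇ Φ p) q v) w = D' v w := by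
  have hgrad : (fun p => ∇ Φ p) =ᶠ[nhds q] fun p => (InnerProductSpace.toDual ℝ F).symm (D p) := by
    filter_upwards [h] with p hp
    rw [gradient, hp.fderiv]
  have hcomp : HasFDerivAt (fun p => (InnerProductSpace.toDual ℝ F).symm (D p)) _ q :=
    (InnerProductSpace.toDual ℝ F).symm.toContinuousLinearEquiv.hasFDerivAt.comp q hD
  rw [hgrad.fderiv_eq, hcomp.fderiv]
  exact InnerProductSpace.toDual_symm_apply

theorem hasFDerivAt_smul_bilinear {F : Type*} [NormedAddCommGroup F] [NormedSpace ℝ F]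
    {f : ℝ → ℝ} {ρ : F → ℝ} {f' : ℝ} {ρ' : F →L[ℝ] ℝ} {q : F} (B : F →L[ℝ] F →L[ℝ] ℝ)
    (hf : HasDerivAt f f' (ρ q)) (hρ : HasFDerivAt ρ ρ' q) :
    HasFDerivAt (fun p => f (ρ p) • B p) (f (ρ q) • B + (f' • ρ').smulRight (B q)) q :=
  (hf.comp_hasFDerivAt q hρ).smul B.hasFDerivAt

open Classical in
theorem hasFDerivAt_potential {V : Type*} [Fintype V] {G : SimpleGraph V}
    {u : Sym2 V → ℝ → ℝ → ℝ} {dbar : Sym2 V → ℝ}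
    (hu : ∀ e ∈ G.edgeSet, ContDiffOn ℝ 1 (fun d => u e d (dbar e)) (Ioi 0))
    {q : Config V} (hq : q ∈ configSpace G) :
    HasFDerivAt (potential G u dbar)
      (∑ e ∈ G.edgeFinset, u e (pairDist q e) (dbar e) • edgeForm e q) q := by
  unfold potential
  refine HasFDerivAt.fun_sum fun e he => ?_
  rw [SimpleGraph.mem_edgeFinset] at he
  exact hasFDerivAt_edgePotential (f := fun d => u e d (dbar e)) (hu e he).continuousOn
    (pairDist_pos hq he)

/-! ### Stresses and the second variation -/

/-- `ω` is an equilibrium stress, supported on `E`, of the framework with positions `p`. -/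
def IsStress {V : Type*} [Fintype V] (p : Config V) (ω : Sym2 V → ℝ) (E : Set (Sym2 V)) : Prop :=
  ∀ w, ∑ᶠ e ∈ E, ω e * edgeForm e p w = 0

/-- The second variation of a potential with edge stresses `ω` and edge stiffnesses `c`. -/
def stiffnessForm {V : Type*} [Fintype V] (p : Config V) (ω c : Sym2 V → ℝ) (E : Set (Sym2 V))
    (v w : Config V) : ℝ :=
  ∑ᶠ e ∈ E, (ω e * edgeForm e v w + c e * (edgeForm e p v * edgeForm e p w))

/-- The stresses `u_e(d_e)` at `p`. -/
def controlStress {V : Type*} (u : Sym2 V → ℝ → ℝ → ℝ) (dbar : Sym2 V → ℝ)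
    (p : Config V) (e : Sym2 V) : ℝ :=
  u e (pairDist p e) (dbar e)

/-- The stiffnesses `u_e'(d_e) / d_e` at `p`. -/
def controlStiffness {V : Type*} (u : Sym2 V → ℝ → ℝ → ℝ) (dbar : Sym2 V → ℝ)
    (p : Config V) (e : Sym2 V) : ℝ :=
  deriv (fun d => u e d (dbar e)) (pairDist p e) * (pairDist p e)⁻¹

section Calculus

variable {V : Type*} [Fintype V] {G : SimpleGraph V} {u : Sym2 V → ℝ → ℝ → ℝ} {dbar : Sym2 V → ℝ}

theorem isCriticalPt_potential_iff
    (hu : ∀ e ∈ G.edgeSet, ContDiffOn ℝ 1 (fun d => u e d (dbar e)) (Ioi 0))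
    {q : Config V} (hq : q ∈ configSpace G) :
    IsCriticalPt (potential G u dbar) q ↔ IsStress q (controlStress u dbar q) G.edgeSet := by
  classical
  refine (hasGradientAt_zero_iff (hasFDerivAt_potential hu hq)).trans (forall_congr' fun w => ?_)
  rw [← SimpleGraph.coe_edgeFinset, finsum_mem_coe_finset, sum_apply]
  exact Iff.rfl

theorem isOpen_configSpace (G : SimpleGraph V) : IsOpen (configSpace G) := by
  have : configSpace G = ⋂ i, ⋂ j, ⋂ _ : G.Adj i j, {p : Config V | p i ≠ p j} := by
    ext p; simp [configSpace]
  rw [this]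
  refine isOpen_iInter_of_finite fun i => isOpen_iInter_of_finite fun j =>
    isOpen_iInter_of_finite fun _ => ?_
  exact isOpen_ne_fun (by fun_prop) (by fun_prop)

/-- Product rule for `u_e(d_e) • edgeForm e`: the linear factor gives the stress term, and the
derivative of the coefficient gives the rank-one stiffness term. -/
theorem inner_hessian_potential
    (hu : ∀ e ∈ G.edgeSet, ContDiffOn ℝ 1 (fun d => u e d (dbar e)) (Ioi 0))
    {q : Config V} (hq : q ∈ configSpace G) (v w : Config V) :
    inner ℝ (hessian (potential G u dbar) q v) w =
      stiffnessForm q (controlStress u dbar q) (controlStiffness u dbar q) G.edgeSet v w := by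
  classical
  have hsum : HasFDerivAt
      (fun p => ∑ e ∈ G.edgeFinset, u e (pairDist p e) (dbar e) • edgeForm e p)
      (∑ e ∈ G.edgeFinset, (u e (pairDist q e) (dbar e) • edgeForm e +
        (deriv (fun d => u e d (dbar e)) (pairDist q e) •
          (pairDist q e)⁻¹ • edgeForm e q).smulRight (edgeForm e q))) q := by
    refine HasFDerivAt.fun_sum fun e he => ?_
    rw [SimpleGraph.mem_edgeFinset] at he
    have hpos := pairDist_pos hq he
    exact hasFDerivAt_smul_bilinear (f := fun d => u e d (dbar e)) (edgeForm e)
      (((hu e he).differentiableOn (by simp)).differentiableAt (Ioi_mem_nhds hpos)).hasDerivAt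
      (hasFDerivAt_pairDist hpos)
  have h := inner_fderiv_gradient (Filter.eventually_of_mem ((isOpen_configSpace G).mem_nhds hq)
    fun p hp => hasFDerivAt_potential hu hp) hsum v w
  rw [hessian, ContinuousLinearMap.coe_coe, stiffnessForm, ← SimpleGraph.coe_edgeFinset,
    finsum_mem_coe_finset, h, sum_apply, sum_apply]
  refine Finset.sum_congr rfl fun e _ => ?_
  simp only [add_apply, smul_apply,
    ContinuousLinearMap.smulRight_apply, smul_eq_mul, controlStress, controlStiffness]
  ring

theorem stiffnessForm_symm (p : Config V) (ω c : Sym2 V → ℝ) (E : Set (Sym2 V))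
    (v w : Config V) : stiffnessForm p ω c E v w = stiffnessForm p ω c E w v := by
  unfold stiffnessForm
  simp only [fun e => edgeForm_symm e v w, mul_comm (edgeForm _ p v)]

end Calculus

/-! ### Eigenvalues of symmetric operators -/

section Spectral

variable {F : Type*} [NormedAddCommGroup F] [InnerProductSpace ℝ F] [FiniteDimensional ℝ F]

/-- Symmetric operators are semisimple, so algebraic and geometric multiplicities agree. -/
theorem LinearMap.IsSymmetric.count_roots_charpoly {T : F →ₗ[ℝ] F} (hT : T.IsSymmetric) (μ : ℝ) :
    T.charpoly.roots.count μ = Module.finrank ℝ (Module.End.eigenspace T μ) := by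
  rw [Polynomial.count_roots, ← LinearMap.finrank_maxGenEigenspace_eq,
    hT.isFinitelySemisimple.maxGenEigenspace_eq_eigenspace]

theorem LinearMap.IsSymmetric.roots_charpoly_pos_iff {T : F →ₗ[ℝ] F} (hT : T.IsSymmetric) :
    (∀ c ∈ T.charpoly.roots, c ≠ 0 → 0 < c) ↔ ∀ v, 0 ≤ inner ℝ (T v) v := by
  have hroot : ∀ c, c ∈ T.charpoly.roots ↔ Module.End.HasEigenvalue T c := fun c => by
    rw [Polynomial.mem_roots (LinearMap.charpoly_monic T).ne_zero,
      Module.End.hasEigenvalue_iff_isRoot_charpoly]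
  constructor
  · intro h v
    let b := hT.eigenvectorBasis (n := Module.finrank ℝ F) rfl
    rw [← b.sum_inner_mul_inner]
    refine Finset.sum_nonneg fun i _ => ?_
    have hev : 0 ≤ hT.eigenvalues rfl i := by
      by_contra hlt
      exact hlt (h _ ((hroot _).2 (hT.hasEigenvalue_eigenvalues rfl i))
        (fun h0 => hlt h0.ge)).le
    rw [hT v (b i), hT.apply_eigenvectorBasis, inner_smul_right, real_inner_comm v]
    simp only [RCLike.ofReal_real_eq_id]
    rw [mul_assoc]
    exact mul_nonneg hev (mul_self_nonneg _)
  · intro h c hc hc0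
    obtain ⟨v, hv⟩ := ((hroot c).1 hc).exists_hasEigenvector
    have := h v
    rw [hv.apply_eq_smul, inner_smul_left, real_inner_self_eq_norm_sq] at this
    have hn : 0 < ‖v‖ ^ 2 := by have := norm_pos_iff.2 hv.2; positivity
    exact lt_of_le_of_ne (nonneg_of_mul_nonneg_left this hn) hc0.symm

end Spectral

/-! ### Linear algebra of the plane -/

section Plane

/-- The rotation of the plane by a right angle. -/
def quarterTurn : EuclideanSpace ℝ (Fin 2) →ₗ[ℝ] EuclideanSpace ℝ (Fin 2) :=
  Matrix.toEuclideanLin !![0, -1; 1, 0]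

theorem quarterTurn_apply_zero (x : EuclideanSpace ℝ (Fin 2)) : quarterTurn x 0 = -x 1 := by
  simp [quarterTurn, Matrix.toLpLin_apply, dotProduct]

theorem quarterTurn_apply_one (x : EuclideanSpace ℝ (Fin 2)) : quarterTurn x 1 = x 0 := by
  simp [quarterTurn, Matrix.toLpLin_apply, dotProduct]

theorem inner_plane (x y : EuclideanSpace ℝ (Fin 2)) :
    inner ℝ x y = x 0 * y 0 + x 1 * y 1 := by
  simp [PiLp.inner_apply, Fin.sum_univ_two, mul_comm]

theorem inner_quarterTurn_left (x y : EuclideanSpace ℝ (Fin 2)) :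
    inner ℝ (quarterTurn x) y = -inner ℝ x (quarterTurn y) := by
  simp only [inner_plane, quarterTurn_apply_zero, quarterTurn_apply_one]; ring

theorem inner_self_quarterTurn (x : EuclideanSpace ℝ (Fin 2)) :
    inner ℝ x (quarterTurn x) = 0 := by
  simp only [inner_plane, quarterTurn_apply_zero, quarterTurn_apply_one]; ring

theorem quarterTurn_eq_zero {x : EuclideanSpace ℝ (Fin 2)} : quarterTurn x = 0 ↔ x = 0 := by
  refine ⟨fun h => ?_, fun h => by simp [h]⟩
  have h0 := congrArg (fun y : EuclideanSpace ℝ (Fin 2) => y 0) h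
  have h1 := congrArg (fun y : EuclideanSpace ℝ (Fin 2) => y 1) h
  simp only [quarterTurn_apply_zero, quarterTurn_apply_one, PiLp.zero_apply] at h0 h1
  ext i; fin_cases i
  · exact h1
  · simpa using h0

theorem det_ne_zero_of_not_collinear {a b c : EuclideanSpace ℝ (Fin 2)}
    (h : ¬ Collinear ℝ {a, b, c}) :
    (c 0 - a 0) * (c 1 - b 1) - (c 1 - a 1) * (c 0 - b 0) ≠ 0 := by
  intro h0
  apply h
  by_cases hca : c = a
  · subst hca
    rw [insert_comm, pair_eq_singleton, pair_comm]
    exact collinear_pair ℝ _ _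
  · have hmem : a ∈ ({a, b, c} : Set (EuclideanSpace ℝ (Fin 2))) := by simp
    rw [collinear_iff_of_mem hmem]
    refine ⟨c - a, ?_⟩
    have hN : (c 0 - a 0) ^ 2 + (c 1 - a 1) ^ 2 ≠ 0 := by
      intro hN
      apply hca
      ext i; fin_cases i <;> simp <;> nlinarith [sq_nonneg (c 0 - a 0), sq_nonneg (c 1 - a 1)]
    intro x hx
    simp only [mem_insert_iff, mem_singleton_iff] at hx
    rcases hx with rfl | rfl | rfl
    · exact ⟨0, by simp⟩
    -- The coefficient of the orthogonal projection of `x - a` onto `c - a`.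
    · refine ⟨((c 0 - a 0) * (x 0 - a 0) + (c 1 - a 1) * (x 1 - a 1)) /
        ((c 0 - a 0) ^ 2 + (c 1 - a 1) ^ 2), ?_⟩
      ext i; fin_cases i
      · simp
        field_simp
        linear_combination (c 1 - a 1) * h0
      · simp
        field_simp
        linear_combination (-(c 0 - a 0)) * h0
    · exact ⟨1, by simp⟩

/-- Two independent vectors of the plane span it. -/
theorem exists_smul_add_smul {x y : EuclideanSpace ℝ (Fin 2)} (h : x 0 * y 1 - x 1 * y 0 ≠ 0)
    (z : EuclideanSpace ℝ (Fin 2)) : ∃ a b : ℝ, z = a • x + b • y := by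
  -- Cramer's rule.
  refine ⟨(z 0 * y 1 - z 1 * y 0) / (x 0 * y 1 - x 1 * y 0),
    (x 0 * z 1 - x 1 * z 0) / (x 0 * y 1 - x 1 * y 0), ?_⟩
  ext i; fin_cases i
  · simp only [Fin.zero_eta, PiLp.add_apply, PiLp.smul_apply, smul_eq_mul]
    rw [div_mul_eq_mul_div, div_mul_eq_mul_div, ← add_div, eq_div_iff h]; ring
  · simp only [Fin.mk_one, PiLp.add_apply, PiLp.smul_apply, smul_eq_mul]
    rw [div_mul_eq_mul_div, div_mul_eq_mul_div, ← add_div, eq_div_iff h]; ring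

theorem eq_zero_of_smul_add_smul {x y : EuclideanSpace ℝ (Fin 2)}
    (h : x 0 * y 1 - x 1 * y 0 ≠ 0) {a b : ℝ} (hab : a • x + b • y = 0) : a = 0 ∧ b = 0 := by
  have h0 := congrArg (fun y : EuclideanSpace ℝ (Fin 2) => y 0) hab
  have h1 := congrArg (fun y : EuclideanSpace ℝ (Fin 2) => y 1) hab
  simp at h0 h1
  constructor
  · exact (mul_eq_zero.1 (by linear_combination y 1 * h0 - y 0 * h1 :
      a * (x 0 * y 1 - x 1 * y 0) = 0)).resolve_right h
  · exact (mul_eq_zero.1 (by linear_combination x 0 * h1 - x 1 * h0 :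
      b * (x 0 * y 1 - x 1 * y 0) = 0)).resolve_right h

end Plane

/-! ### Rigid motions and gluing along an independent partition -/

/-- `v` restricts on `S` to an infinitesimal rigid motion of the positions `p`. -/
def RigidOn {V : Type*} (p : Config V) (S : Set V) (v : Config V) : Prop :=
  ∃ (a : ℝ) (b : EuclideanSpace ℝ (Fin 2)), ∀ i ∈ S, v i = a • quarterTurn (p i) + b

section Stage

variable {V : Type*} {p : Config V} {W : Set V} {E : Set (Sym2 V)} {P : Set (Set (Sym2 V))}

theorem RigidOn.mono {S T : Set V} {v : Config V} (h : RigidOn p T v) (hST : S ⊆ T) :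
    RigidOn p S v := by
  obtain ⟨a, b, hab⟩ := h
  exact ⟨a, b, fun i hi => hab i (hST hi)⟩

theorem RigidOn.sub {S : Set V} {v w : Config V} (hv : RigidOn p S v) (hw : RigidOn p S w) :
    RigidOn p S (v - w) := by
  obtain ⟨a, b, hab⟩ := hv
  obtain ⟨c, d, hcd⟩ := hw
  refine ⟨a - c, b - d, fun i hi => ?_⟩
  rw [PiLp.sub_apply, hab i hi, hcd i hi, sub_smul]; abel

theorem incidentVerts_mono {C D : Set (Sym2 V)} (h : C ⊆ D) :
    incidentVerts C ⊆ incidentVerts D := fun _ ⟨e, he, hv⟩ => ⟨e, h he, hv⟩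

theorem left_mem_incidentVerts {C : Set (Sym2 V)} {i j : V} (h : s(i, j) ∈ C) :
    i ∈ incidentVerts C := ⟨_, h, Sym2.mem_mk_left i j⟩

theorem right_mem_incidentVerts {C : Set (Sym2 V)} {i j : V} (h : s(i, j) ∈ C) :
    j ∈ incidentVerts C := ⟨_, h, Sym2.mem_mk_right i j⟩

theorem incidentVerts_singleton (i j : V) : incidentVerts {s(i, j)} = {i, j} := by
  ext v; simp [incidentVerts]

theorem IndepPartitionStage.incidentVerts_subset (h : IndepPartitionStage p W E P) :
    incidentVerts E ⊆ W ∧ ∀ C ∈ P, C ⊆ E := by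
  induction h with
  | init a b hab => simp [incidentVerts_singleton]
  | @aligned W E P h i j k C hC hij hk hcol ih =>
    have hi := ih.1 (left_mem_incidentVerts (ih.2 C hC hij))
    have hj := ih.1 (right_mem_incidentVerts (ih.2 C hC hij))
    constructor
    · rintro v ⟨e, he | rfl | rfl, hv⟩
      · exact Or.inr (ih.1 ⟨e, he, hv⟩)
      all_goals
        rcases Sym2.mem_iff.1 hv with rfl | rfl <;> simp [*]
    · rintro D (rfl | hD)
      · exact union_subset_union_left _ (ih.2 C hC)
      · exact (ih.2 D hD.1).trans subset_union_left
  | @notAligned W E P h i j k hij hk hcol ih =>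
    have hi := ih.1 (left_mem_incidentVerts hij)
    have hj := ih.1 (right_mem_incidentVerts hij)
    constructor
    · rintro v ⟨e, he | rfl | rfl, hv⟩
      · exact Or.inr (ih.1 ⟨e, he, hv⟩)
      all_goals
        rcases Sym2.mem_iff.1 hv with rfl | rfl <;> simp [*]
    · rintro D (hD | rfl | rfl)
      · exact (ih.2 D hD).trans subset_union_left
      · simp
      · simp

theorem IndepPartitionStage.sUnion_eq (h : IndepPartitionStage p W E P) : ⋃₀ P = E := by
  induction h with
  | init a b hab => simp
  | @aligned W E P h i j k C hC hij hk hcol ih =>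
    have : ⋃₀ P = C ∪ ⋃₀ (P \ {C}) := by
      rw [← sUnion_insert, insert_sdiff_singleton, insert_eq_of_mem hC]
    rw [sUnion_insert, ← ih, this]
    ac_rfl
  | @notAligned W E P h i j k hij hk hcol ih =>
    rw [sUnion_union, ih, sUnion_pair]; rfl

/-- An edge at a vertex outside a stage does not belong to the stage. -/
theorem IndepPartitionStage.notMem_of_notMem (h : IndepPartitionStage p W E P) {k : V} (hk : k ∉ W)
    {C : Set (Sym2 V)} (hC : C ∈ P) (i : V) : s(i, k) ∉ C := fun hmem =>
  hk (h.incidentVerts_subset.1 (right_mem_incidentVerts (h.incidentVerts_subset.2 C hC hmem)))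

theorem ne_of_not_collinear {i j k : V} (h : ¬ Collinear ℝ {p i, p j, p k}) : i ≠ j := by
  rintro rfl
  simp [collinear_pair] at h

/-- Every added edge contains the new vertex `k`, which no earlier edge does. -/
theorem IndepPartitionStage.pairwiseDisjoint (h : IndepPartitionStage p W E P) :
    P.PairwiseDisjoint id := by
  induction h with
  | init a b hab => simp
  | @aligned W E P h i j k C hC hij hk hcol ih =>
    refine (ih.subset sdiff_subset).insert fun D hD _ => ?_
    refine disjoint_union_left.2 ⟨ih hC hD.1 (Ne.symm hD.2), ?_⟩
    simp [h.notMem_of_notMem hk hD.1]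
  | @notAligned W E P h i j k hij hk hcol ih =>
    have hne := ne_of_not_collinear hcol
    have hk' : i ≠ k := by
      rintro rfl; exact hk (h.incidentVerts_subset.1 (left_mem_incidentVerts hij))
    rw [union_comm, insert_union, singleton_union]
    refine (ih.insert fun D hD _ => ?_).insert fun D hD hDne => ?_
    · simp [h.notMem_of_notMem hk hD]
    · rcases hD with rfl | hD
      · simp [hne, hk']
      · simp [h.notMem_of_notMem hk hD]

/-- Pieces of an independent partition can only move rigidly together. -/
theorem IndepPartitionStage.rigidOn (h : IndepPartitionStage p W E P)
    (hp : ∀ i j, s(i, j) ∈ E → p i ≠ p j) {v : Config V}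
    (hv : ∀ C ∈ P, RigidOn p (incidentVerts C) v) : RigidOn p W v := by
  induction h with
  | init a b hab => simpa [incidentVerts_singleton] using hv
  | @aligned W E P h i j k C hC hij hk hcol ih =>
    have hijE := h.incidentVerts_subset.2 C hC hij
    have hi := h.incidentVerts_subset.1 (left_mem_incidentVerts hijE)
    have hj := h.incidentVerts_subset.1 (right_mem_incidentVerts hijE)
    have hvC := hv _ (mem_insert _ _)
    obtain ⟨a, b, hab⟩ := ih (fun i j hij => hp i j (Or.inl hij)) fun D hD => by
      by_cases hDC : D = C
      · subst hDC
        exact hvC.mono (incidentVerts_mono subset_union_left)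
      · exact hv D (Or.inr ⟨hD, hDC⟩)
    obtain ⟨c, d, hcd⟩ := hvC
    have hci := hcd i (left_mem_incidentVerts (Or.inl hij))
    have hcj := hcd j (right_mem_incidentVerts (Or.inl hij))
    have hck := hcd k (right_mem_incidentVerts (i := i) (by simp))
    rw [hab i hi] at hci
    rw [hab j hj] at hcj
    -- Two rigid motions that agree at the distinct points `p i` and `p j` have the same angular
    -- velocity, hence the same translation.
    have hsub : (a - c) • quarterTurn (p i - p j) = 0 := by
      rw [map_sub, smul_sub, sub_smul, sub_smul]
      linear_combination (norm := module) hci - hcj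
    have hac : a = c := by
      rcases smul_eq_zero.1 hsub with h0 | h0
      · exact sub_eq_zero.1 h0
      · exact absurd (sub_eq_zero.1 (quarterTurn_eq_zero.1 h0)) (hp i j (Or.inl hijE))
    subst hac
    have hbd : b = d := add_left_cancel hci
    subst hbd
    refine ⟨a, b, ?_⟩
    rintro l (rfl | hl)
    · exact hck
    · exact hab l hl
  | @notAligned W E P h i j k hij hk hcol ih =>
    have hi := h.incidentVerts_subset.1 (left_mem_incidentVerts hij)
    have hj := h.incidentVerts_subset.1 (right_mem_incidentVerts hij)
    obtain ⟨a, b, hab⟩ := ih (fun i j hij => hp i j (Or.inl hij)) fun D hD => hv D (Or.inl hD)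
    obtain ⟨a₁, b₁, h1⟩ := hv {s(i, k)} (by simp)
    obtain ⟨a₂, b₂, h2⟩ := hv {s(j, k)} (by simp)
    rw [incidentVerts_singleton] at h1 h2
    have h1i := h1 i (by simp)
    have h1k := h1 k (by simp)
    have h2j := h2 j (by simp)
    have h2k := h2 k (by simp)
    rw [hab i hi] at h1i
    rw [hab j hj] at h2j
    -- Both bars prescribe the velocity of `k`. Equating the two leaves a relation between the
    -- independent vectors `p k - p i` and `p k - p j`, so neither bar turns relative to the old
    -- body.
    have hlin : quarterTurn ((a₁ - a) • (p k - p i) + (a - a₂) • (p k - p j)) = 0 := by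
      simp only [map_add, map_smul, map_sub]
      rw [h1k] at h2k
      linear_combination (norm := module) h2k + h1i - h2j
    have hz := eq_zero_of_smul_add_smul
      (by simpa using det_ne_zero_of_not_collinear hcol) (quarterTurn_eq_zero.1 hlin)
    refine ⟨a, b, ?_⟩
    rintro l (rfl | hl)
    · rw [sub_eq_zero.1 hz.1] at h1i h1k
      rw [h1k, ← add_left_cancel h1i]
    · exact hab l hl

theorem rigidOn_congr {S : Set V} {v w : Config V} (h : ∀ i ∈ S, v i = w i) :
    RigidOn p S v ↔ RigidOn p S w :=
  exists_congr fun _ => exists_congr fun _ => forall₂_congr fun i hi => by rw [h i hi]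

open Classical in
/-- Deformations of the pieces of an independent partition can be glued, up to rigid motions. -/
theorem IndepPartitionStage.exists_glue (h : IndepPartitionStage p W E P)
    (F : Set (Sym2 V) → Config V) :
    ∃ v : Config V, ∀ C ∈ P, RigidOn p (incidentVerts C) (v - F C) := by
  induction h generalizing F with
  | init a b hab =>
    refine ⟨F {s(a, b)}, fun C hC => ⟨0, 0, fun i hi => ?_⟩⟩
    rw [mem_singleton_iff.1 hC]; simp
  | @aligned W E P h i j k C hC hij hk hcol ih =>
    -- The old piece `C` must follow the data prescribed for the enlarged piece that replaces it.
    obtain ⟨v, hv⟩ := ih (Function.update F C (F (C ∪ {s(i, k), s(j, k)})))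
    have hnot : ∀ D ∈ P, ∀ l ∈ incidentVerts D, l ≠ k := by
      rintro D hD l hl rfl
      exact hk (h.incidentVerts_subset.1 (incidentVerts_mono (h.incidentVerts_subset.2 D hD) hl))
    have hvC := hv C hC
    rw [Function.update_self] at hvC
    obtain ⟨a, b, hab⟩ := hvC
    -- The new vertex receives the same rigid correction `(a, b)` as the rest of its piece.
    let v' : Config V := WithLp.toLp 2 fun l =>
      if l = k then F (C ∪ {s(i, k), s(j, k)}) k + (a • quarterTurn (p k) + b) else v l
    have hv'k : v' k = F (C ∪ {s(i, k), s(j, k)}) k + (a • quarterTurn (p k) + b) := by simp [v']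
    have hv' : ∀ l, l ≠ k → v' l = v l := fun l hl => by simp [v', hl]
    refine ⟨v', ?_⟩
    rintro D (rfl | hD)
    · refine ⟨a, b, fun l hl => ?_⟩
      by_cases hlk : l = k
      · subst hlk
        rw [PiLp.sub_apply, hv'k]; abel
      · have hlC : l ∈ incidentVerts C := by
          obtain ⟨e, he | rfl | rfl, hle⟩ := hl
          · exact ⟨e, he, hle⟩
          · rcases Sym2.mem_iff.1 hle with rfl | rfl
            · exact left_mem_incidentVerts hij
            · exact absurd rfl hlk
          · rcases Sym2.mem_iff.1 hle with rfl | rfl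
            · exact right_mem_incidentVerts hij
            · exact absurd rfl hlk
        rw [PiLp.sub_apply, hv' l hlk, ← hab l hlC, PiLp.sub_apply]
    · have := hv D hD.1
      rw [Function.update_of_ne hD.2] at this
      refine (rigidOn_congr fun l hl => ?_).1 this
      rw [PiLp.sub_apply, PiLp.sub_apply, hv' l (hnot D hD.1 l hl)]
  | @notAligned W E P h i j k hij hk hcol ih =>
    obtain ⟨v, hv⟩ := ih F
    have hi := h.incidentVerts_subset.1 (left_mem_incidentVerts hij)
    have hj := h.incidentVerts_subset.1 (right_mem_incidentVerts hij)
    have hik : i ≠ k := by rintro rfl; exact hk hi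
    have hjk : j ≠ k := by rintro rfl; exact hk hj
    have hnot : ∀ D ∈ P, ∀ l ∈ incidentVerts D, l ≠ k := by
      rintro D hD l hl rfl
      exact hk (h.incidentVerts_subset.1 (incidentVerts_mono (h.incidentVerts_subset.2 D hD) hl))
    have hdet : (quarterTurn (p k - p i)) 0 * (quarterTurn (p k - p j)) 1 -
        (quarterTurn (p k - p i)) 1 * (quarterTurn (p k - p j)) 0 ≠ 0 := by
      have := det_ne_zero_of_not_collinear hcol
      simp only [quarterTurn_apply_zero, quarterTurn_apply_one, PiLp.sub_apply]
      intro h0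
      exact this (by linear_combination h0)
    -- Each bar proposes a velocity for `k`, adjustable by rotating the bar about its old end. The
    -- two adjustment directions span the plane, so the proposals can be made to agree, with angular
    -- velocities `a` and `-b`.
    obtain ⟨a, b, hab⟩ := exists_smul_add_smul hdet
      ((v j - F {s(j, k)} j + F {s(j, k)} k) - (v i - F {s(i, k)} i + F {s(i, k)} k))
    let x := v i - F {s(i, k)} i + F {s(i, k)} k + a • quarterTurn (p k - p i)
    let v' : Config V := WithLp.toLp 2 fun l => if l = k then x else v l
    have hv'k : v' k = x := by simp [v']
    have hv' : ∀ l, l ≠ k → v' l = v l := fun l hl => by simp [v', hl]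
    refine ⟨v', ?_⟩
    rintro D (hD | rfl | rfl)
    · refine (rigidOn_congr fun l hl => ?_).1 (hv D hD)
      rw [PiLp.sub_apply, PiLp.sub_apply, hv' l (hnot D hD l hl)]
    · refine ⟨a, v i - F {s(i, k)} i - a • quarterTurn (p i), fun l hl => ?_⟩
      rw [incidentVerts_singleton] at hl
      rcases hl with rfl | rfl
      · rw [PiLp.sub_apply, hv' _ hik]; abel
      · rw [PiLp.sub_apply, hv'k]
        simp only [x, map_sub, smul_sub]; abel
    · refine ⟨-b, v j - F {s(j, k)} j + b • quarterTurn (p j), fun l hl => ?_⟩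
      rw [incidentVerts_singleton] at hl
      rcases hl with rfl | rfl
      · rw [PiLp.sub_apply, hv' _ hjk, neg_smul]; abel
      · rw [PiLp.sub_apply, hv'k]
        simp only [x]
        simp only [map_sub, smul_sub] at hab ⊢
        linear_combination (norm := module) -hab

end Stage

/-! ### Equilibrium stresses restrict to the pieces -/

section Stress

variable {V : Type*} [Fintype V] {p : Config V} {W : Set V} {E : Set (Sym2 V)}
  {P : Set (Set (Sym2 V))}

theorem isStress_congr {ω ω' : Sym2 V → ℝ} {C : Set (Sym2 V)} (h : ∀ e ∈ C, ω e = ω' e) :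
    IsStress p ω C ↔ IsStress p ω' C := by
  refine forall_congr' fun w => ?_
  rw [finsum_mem_congr rfl fun e he => by rw [h e he]]

theorem finsum_mem_union_pair {M : Type*} [AddCommMonoid M] (f : Sym2 V → M) {C : Set (Sym2 V)}
    {e₁ e₂ : Sym2 V} (h₁ : e₁ ∉ C) (h₂ : e₂ ∉ C) (h : e₁ ≠ e₂) :
    ∑ᶠ e ∈ C ∪ {e₁, e₂}, f e = ∑ᶠ e ∈ C, f e + (f e₁ + f e₂) := by
  rw [finsum_mem_union (by simp [h₁, h₂]) (toFinite _) (toFinite _), finsum_mem_pair h]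

theorem edgeForm_eq_zero_of_support {e : Sym2 V} {v w : Config V} (h : ∀ i ∈ e, w i = 0) :
    edgeForm e v w = 0 := by
  induction e with | _ i j => simp [h i, h j]

/-- Force balance at a vertex with exactly two edges. -/
theorem IsStress.balance {ω : Sym2 V → ℝ} {i j k : V} (hk : k ∉ incidentVerts E) (hik : i ≠ k)
    (hjk : j ≠ k) (hij : i ≠ j) (h : IsStress p ω (E ∪ {s(i, k), s(j, k)})) :
    ω s(i, k) • (p k - p i) + ω s(j, k) • (p k - p j) = 0 := by
  classical
  set y := ω s(i, k) • (p k - p i) + ω s(j, k) • (p k - p j) with hy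
  -- Testing against the displacement that moves only `k`, by the resultant force `y`, leaves `⟪y,
  -- y⟫ = 0`.
  let w : Config V := WithLp.toLp 2 fun l => if l = k then y else 0
  have hw := h w
  rw [finsum_mem_union_pair _ (fun hm => hk (right_mem_incidentVerts hm))
    (fun hm => hk (right_mem_incidentVerts hm)) (by simp [hij, hik]),
    finsum_mem_congr rfl (g := fun _ => (0 : ℝ)) fun e he => by
      rw [edgeForm_eq_zero_of_support, mul_zero]
      intro l hl
      have : l ≠ k := by rintro rfl; exact hk ⟨e, he, hl⟩
      simp [w, this]] at hw
  have hwi : w i = 0 := by simp [w, hik]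
  have hwj : w j = 0 := by simp [w, hjk]
  have hwk : w k = y := by simp [w]
  rw [finsum_mem_zero, edgeForm_mk, edgeForm_mk, hwi, hwj, hwk, zero_sub, zero_add,
    ← neg_sub (p k), ← neg_sub (p k), inner_neg_neg, inner_neg_neg, ← real_inner_smul_left,
    ← real_inner_smul_left, ← inner_add_left, ← hy] at hw
  exact inner_self_eq_zero.1 hw

/-- An equilibrium stress restricts to each piece of an independent partition. -/
theorem IndepPartitionStage.isStress (h : IndepPartitionStage p W E P)
    (hp : ∀ i j, s(i, j) ∈ E → p i ≠ p j) {ω : Sym2 V → ℝ} (hω : IsStress p ω E) :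
    ∀ C ∈ P, IsStress p ω C := by
  classical
  induction h generalizing ω with
  | init a b hab => simpa using hω
  | @aligned W E P h i j k C hC hij hk hcol ih =>
    have hijE := h.incidentVerts_subset.2 C hC hij
    have hi := h.incidentVerts_subset.1 (left_mem_incidentVerts hijE)
    have hj := h.incidentVerts_subset.1 (right_mem_incidentVerts hijE)
    have hik : i ≠ k := by rintro rfl; exact hk hi
    have hjk : j ≠ k := by rintro rfl; exact hk hj
    have hpij := hp i j (Or.inl hijE)
    have hne : i ≠ j := by rintro rfl; exact hpij rfl
    have hkE : k ∉ incidentVerts E := fun hm => hk (h.incidentVerts_subset.1 hm)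
    have hbal := hω.balance hkE hik hjk hne
    obtain ⟨t, ht⟩ : ∃ t : ℝ, p i - p k = t • (p i - p j) := by
      obtain ⟨d, hd⟩ := (collinear_iff_of_mem (by simp : p i ∈ ({p i, p j, p k} : Set _))).1 hcol
      obtain ⟨r, hr⟩ := hd (p j) (by simp)
      obtain ⟨s, hs⟩ := hd (p k) (by simp)
      simp only [vadd_eq_add] at hr hs
      have hr0 : r ≠ 0 := by rintro rfl; simp at hr; exact hpij hr.symm
      refine ⟨s / r, ?_⟩
      rw [hr, hs]
      simp [smul_smul, div_mul_cancel₀ _ hr0]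
    -- The two forces at `k` cancel and all bars are parallel, so the pair of new edges acts as a
    -- stress `ω s(i, k) * t` on the old edge.
    have hpair : ∀ w, ω s(i, k) * edgeForm s(i, k) p w + ω s(j, k) * edgeForm s(j, k) p w =
        ω s(i, k) * t * edgeForm s(i, j) p w := fun w => by
      have h2 : ω s(j, k) • (p j - p k) = -(ω s(i, k) • (p i - p k)) := by
        rw [smul_sub, smul_sub] at hbal ⊢
        linear_combination (norm := module) -hbal
      simp only [edgeForm_mk]
      rw [mul_assoc, ← real_inner_smul_left, ← real_inner_smul_left, h2, ← real_inner_smul_left,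
        ← real_inner_smul_left, ← ht, inner_neg_left, ← sub_eq_add_neg, ← inner_sub_right]
      congr 1; abel
    -- Transferring this stress to `s(i, j)` removes `k`. The transfer is reversible, so it is used
    -- for `E` to enter the induction and for `C` to leave it.
    let ω' := Function.update ω s(i, j) (ω s(i, j) + ω s(i, k) * t)
    have hω' : ∀ D : Set (Sym2 V), s(i, j) ∈ D → s(i, k) ∉ D → s(j, k) ∉ D →
        (IsStress p ω' D ↔ IsStress p ω (D ∪ {s(i, k), s(j, k)})) := by
      intro D hD h1 h2
      refine forall_congr' fun w => ?_
      rw [finsum_mem_union_pair _ h1 h2 (by simp [hne, hik]), hpair]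
      have hins : D = insert s(i, j) (D \ {s(i, j)}) := by
        rw [insert_sdiff_singleton, insert_eq_of_mem hD]
      rw [hins, finsum_mem_insert _ (by simp) (toFinite _),
        finsum_mem_insert _ (by simp) (toFinite _)]
      have : ∑ᶠ e ∈ D \ {s(i, j)}, ω' e * edgeForm e p w =
          ∑ᶠ e ∈ D \ {s(i, j)}, ω e * edgeForm e p w :=
        finsum_mem_congr rfl fun e he => by
          rw [show ω' e = ω e from Function.update_of_ne he.2 _ _]
      rw [this, show ω' s(i, j) = ω s(i, j) + ω s(i, k) * t from Function.update_self _ _ _]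
      constructor <;> intro h0 <;> linear_combination h0
    have hE' := ih (fun i j hij => hp i j (Or.inl hij)) ((hω' E hijE
      (fun hm => hkE (right_mem_incidentVerts hm)) (fun hm => hkE (right_mem_incidentVerts hm))).2 hω)
    rintro D (rfl | hD)
    · exact (hω' C hij (h.notMem_of_notMem hk hC i) (h.notMem_of_notMem hk hC j)).1 (hE' C hC)
    · refine (isStress_congr fun e he => ?_).1 (hE' D hD.1)
      refine Function.update_of_ne ?_ _ _
      rintro rfl
      exact Set.disjoint_left.1 (h.pairwiseDisjoint hC hD.1 (Ne.symm hD.2)) hij he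
  | @notAligned W E P h i j k hij hk hcol ih =>
    have hi := h.incidentVerts_subset.1 (left_mem_incidentVerts hij)
    have hj := h.incidentVerts_subset.1 (right_mem_incidentVerts hij)
    have hik : i ≠ k := by rintro rfl; exact hk hi
    have hjk : j ≠ k := by rintro rfl; exact hk hj
    have hne := ne_of_not_collinear hcol
    have hkE : k ∉ incidentVerts E := fun hm => hk (h.incidentVerts_subset.1 hm)
    obtain ⟨h1, h2⟩ := eq_zero_of_smul_add_smul
      (by simpa using det_ne_zero_of_not_collinear hcol) (hω.balance hkE hik hjk hne)
    have hE : IsStress p ω E := fun w => by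
      have := hω w
      rwa [finsum_mem_union_pair _ (fun hm => hkE (right_mem_incidentVerts hm))
        (fun hm => hkE (right_mem_incidentVerts hm)) (by simp [hne, hik]), h1, h2, zero_mul,
        zero_mul, add_zero, add_zero] at this
    rintro D (hD | rfl | rfl)
    · exact ih (fun i j hij => hp i j (Or.inl hij)) hE D hD
    · intro w; rw [finsum_mem_singleton, h1, zero_mul]
    · intro w; rw [finsum_mem_singleton, h2, zero_mul]

/-- Infinitesimal rigid motions lie in the kernel of the second variation at an equilibrium. -/
theorem RigidOn.stiffnessForm_eq_zero {ω c : Sym2 V → ℝ} {C : Set (Sym2 V)} {v : Config V}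
    (hv : RigidOn p (incidentVerts C) v) (hω : IsStress p ω C) (w : Config V) :
    stiffnessForm p ω c C v w = 0 := by
  obtain ⟨a, b, hab⟩ := hv
  -- Skewness of the quarter turn moves the rotation from `v` to `w`: the stress term becomes the
  -- equilibrium equation tested on `Jw`. The stiffness term vanishes since a rotation does not
  -- change lengths to first order.
  let Jw : Config V := WithLp.toLp 2 fun l => -a • quarterTurn (w l)
  rw [← hω Jw]
  refine finsum_mem_congr rfl fun e he => ?_
  induction e with | _ i j =>
  have hvij : v i - v j = a • quarterTurn (p i - p j) := by
    rw [hab i (left_mem_incidentVerts he), hab j (right_mem_incidentVerts he), map_sub, smul_sub]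
    abel
  have hJ : Jw i - Jw j = -a • quarterTurn (w i - w j) := by
    simp only [Jw, map_sub, smul_sub]
  rw [edgeForm_mk, edgeForm_mk, edgeForm_mk, edgeForm_mk, hvij, hJ, inner_smul_right,
    inner_self_quarterTurn, inner_smul_right, real_inner_smul_left, inner_quarterTurn_left]
  ring

end Stress

/-! ### Invariance under SE(2) -/

section Invariance

theorem fderiv_comp_isometryEquiv_add {F : Type*} [NormedAddCommGroup F] [InnerProductSpace ℝ F]
    {H : Type*} [NormedAddCommGroup H] [NormedSpace ℝ H]
    (f : F → H) (A : F ≃ₗᵢ[ℝ] F) (b x w : F) :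
    fderiv ℝ (fun y => f (A y + b)) x w = fderiv ℝ f (A x + b) (A w) := by
  have h := A.toContinuousLinearEquiv.comp_right_fderiv (f := fun y => f (y + b)) (x := x)
  rw [fderiv_comp_add_right] at h
  exact congrArg (fun L : F →L[ℝ] H => L w) h

/-- No differentiability is needed: composing with an invertible affine isometry transforms `fderiv`
correctly even where it takes its default value. -/
theorem gradient_of_invariant {F : Type*} [NormedAddCommGroup F] [InnerProductSpace ℝ F]
    [CompleteSpace F] {Φ : F → ℝ} {A : F ≃ₗᵢ[ℝ] F} {b : F}
    (h : ∀ x, Φ (A x + b) = Φ x) (x : F) : ∇ Φ (A x + b) = A (∇ Φ x) := by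
  refine ext_inner_right ℝ fun w => ?_
  have h1 := fderiv_comp_isometryEquiv_add Φ A b x (A.symm w)
  simp only [h, A.apply_symm_apply] at h1
  rw [A.inner_map_eq_flip, inner_gradient_left, inner_gradient_left, h1]

theorem fderiv_gradient_of_invariant {F : Type*} [NormedAddCommGroup F] [InnerProductSpace ℝ F]
    [CompleteSpace F] {Φ : F → ℝ} {A : F ≃ₗᵢ[ℝ] F} {b : F}
    (h : ∀ x, Φ (A x + b) = Φ x) (x w : F) :
    fderiv ℝ (fun y => ∇ Φ y) (A x + b) (A w) = A (fderiv ℝ (fun y => ∇ Φ y) x w) := by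
  rw [← fderiv_comp_isometryEquiv_add (fun y => ∇ Φ y)]
  simp only [gradient_of_invariant h]
  have := A.comp_fderiv (f := fun y => ∇ Φ y) (x := x)
  exact congrArg (fun L : F →L[ℝ] F => L w) this

theorem hasGradientAt_zero_of_invariant {F : Type*} [NormedAddCommGroup F]
    [InnerProductSpace ℝ F] [CompleteSpace F] {Φ : F → ℝ} {A : F ≃ₗᵢ[ℝ] F} {b : F}
    (h : ∀ x, Φ (A x + b) = Φ x) {x : F} (hx : HasGradientAt Φ 0 x) :
    HasGradientAt Φ 0 (A x + b) := by
  rw [hasGradientAt_iff_hasFDerivAt, map_zero] at hx ⊢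
  have hg : HasFDerivAt (fun y => A.symm (y - b)) (A.symm : F →L[ℝ] F) (A x + b) :=
    (A.symm : F →L[ℝ] F).hasFDerivAt.comp (A x + b) ((hasFDerivAt_id _).sub_const b)
  have hΦ : (fun y => Φ (A.symm (y - b))) = Φ := by
    funext y
    rw [← h, A.apply_symm_apply, sub_add_cancel]
  have hc := HasFDerivAt.comp (f := fun y => A.symm (y - b)) (A x + b)
    (by simpa using hx) hg
  rw [ContinuousLinearMap.zero_comp] at hc
  exact hΦ ▸ hc

theorem norm_toEuclideanLin_of_mem_specialOrthogonalGroup {n : Type*} [Fintype n] [DecidableEq n]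
    {θ : Matrix n n ℝ} (hθ : θ ∈ Matrix.specialOrthogonalGroup n ℝ) (x : EuclideanSpace ℝ n) :
    ‖Matrix.toEuclideanLin θ x‖ = ‖x‖ := by
  have h1 := (Matrix.mem_orthogonalGroup_iff' n ℝ).1 (Matrix.mem_specialOrthogonalGroup_iff.1 hθ).1
  have h2 : LinearMap.adjoint (Matrix.toEuclideanLin θ) (Matrix.toEuclideanLin θ x) = x := by
    rw [← Matrix.toEuclideanLin_conjTranspose_eq_adjoint, Matrix.conjTranspose_eq_transpose_of_trivial]
    simp only [Matrix.toLpLin_apply, Matrix.mulVec_mulVec, h1, Matrix.one_mulVec]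
  have h3 : inner ℝ (Matrix.toEuclideanLin θ x) (Matrix.toEuclideanLin θ x) = inner ℝ x x := by
    rw [← LinearMap.adjoint_inner_left, h2]
  rw [real_inner_self_eq_norm_sq, real_inner_self_eq_norm_sq] at h3
  exact (sq_eq_sq₀ (norm_nonneg _) (norm_nonneg _)).1 h3

variable {V : Type*} [Fintype V] {G : SimpleGraph V} {u : Sym2 V → ℝ → ℝ → ℝ} {dbar : Sym2 V → ℝ}

/-- A rotation applied at every vertex is an isometry of the whole configuration space, and the
potential depends only on distances. -/
theorem exists_isometry_of_mem_orbitSE2 {p q : Config V} (hq : q ∈ orbitSE2 p) :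
    ∃ (A : Config V ≃ₗᵢ[ℝ] Config V) (b : Config V), q = A p + b ∧
      ∀ G u dbar x, potential (V := V) G u dbar (A x + b) = potential G u dbar x := by
  obtain ⟨θ, hθ, v, hv⟩ := hq
  let L : EuclideanSpace ℝ (Fin 2) →ₗᵢ[ℝ] EuclideanSpace ℝ (Fin 2) :=
    ⟨Matrix.toEuclideanLin θ, norm_toEuclideanLin_of_mem_specialOrthogonalGroup hθ⟩
  let A : Config V ≃ₗᵢ[ℝ] Config V :=
    LinearIsometryEquiv.piLpCongrRight 2 fun _ => L.toLinearIsometryEquiv rfl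
  let b : Config V := WithLp.toLp 2 fun _ => v
  have hA : ∀ x i, (A x + b) i = Matrix.toEuclideanLin θ (x i) + v := fun x i => rfl
  refine ⟨A, b, ?_, fun G u dbar x => ?_⟩
  · ext1 i
    rw [hv, hA]
  · have hd : ∀ e, pairDist (A x + b) e = pairDist x e := by
      intro e
      induction e with | _ i j =>
      rw [pairDist_mk, pairDist_mk, hA, hA, add_sub_add_right_eq_sub, ← map_sub,
        norm_toEuclideanLin_of_mem_specialOrthogonalGroup hθ]
    simp only [potential, hd]

theorem self_mem_orbitSE2 {V : Type*} (p : Config V) : p ∈ orbitSE2 p :=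
  ⟨1, one_mem _, 0, fun i => by simp⟩

theorem isCriticalOrbit_potential_iff {p : Config V} :
    IsCriticalOrbit (potential G u dbar) (orbitSE2 p) ↔ IsCriticalPt (potential G u dbar) p := by
  refine ⟨fun h => h p (self_mem_orbitSE2 p), fun h q hq => ?_⟩
  obtain ⟨A, b, rfl, hA⟩ := exists_isometry_of_mem_orbitSE2 hq
  exact hasGradientAt_zero_of_invariant (hA G u dbar) h

theorem hessianEigenvalues_potential_of_mem_orbitSE2 {p q : Config V} (hq : q ∈ orbitSE2 p) :
    hessianEigenvalues (potential G u dbar) q = hessianEigenvalues (potential G u dbar) p := by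
  obtain ⟨A, b, rfl, hA⟩ := exists_isometry_of_mem_orbitSE2 hq
  have hconj : hessian (potential G u dbar) (A p + b) =
      A.toLinearEquiv.conj (hessian (potential G u dbar) p) := by
    refine LinearMap.ext fun w => ?_
    have := fderiv_gradient_of_invariant (hA G u dbar) p (A.symm w)
    rw [A.apply_symm_apply] at this
    exact this
  rw [hessianEigenvalues, hessianEigenvalues, hconj, LinearEquiv.charpoly_conj]

theorem isNondegenerateOrbit_potential_iff {p : Config V}
    (hp : IsCriticalPt (potential G u dbar) p) :
    IsNondegenerateOrbit (potential G u dbar) (orbitSE2 p) ↔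
      (hessianEigenvalues (potential G u dbar) p).count 0 = 3 := by
  refine ⟨fun h => h.2 p (self_mem_orbitSE2 p), fun h =>
    ⟨isCriticalOrbit_potential_iff.2 hp, fun q hq => ?_⟩⟩
  rwa [hessianEigenvalues_potential_of_mem_orbitSE2 hq]

theorem isExpStableOrbit_potential_iff {p : Config V} :
    IsExpStableOrbit (potential G u dbar) (orbitSE2 p) ↔
      IsNondegenerateOrbit (potential G u dbar) (orbitSE2 p) ∧
        ∀ c ∈ hessianEigenvalues (potential G u dbar) p, c ≠ 0 → 0 < c := by
  refine and_congr_right fun _ => ⟨fun h => h p (self_mem_orbitSE2 p), fun h q hq => ?_⟩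
  rwa [hessianEigenvalues_potential_of_mem_orbitSE2 hq]

end Invariance

/-! ### Nondegeneracy and stability in terms of the second variation -/

section Criteria

variable {V : Type*} [Fintype V] {G : SimpleGraph V} {u : Sym2 V → ℝ → ℝ → ℝ} {dbar : Sym2 V → ℝ}

/-- The infinitesimal rigid motion of `p` with angular velocity `a` and translation `b`. -/
def rigidVelocity (p : Config V) : ℝ × EuclideanSpace ℝ (Fin 2) →ₗ[ℝ] Config V where
  toFun x := WithLp.toLp 2 fun i => x.1 • quarterTurn (p i) + x.2
  map_add' x y := by
    ext1 i
    simp only [PiLp.add_apply, Prod.fst_add, Prod.snd_add]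
    module
  map_smul' c x := by
    ext1 i
    simp only [PiLp.smul_apply, Prod.smul_fst, Prod.smul_snd, RingHom.id_apply]
    module

theorem mem_range_rigidVelocity {V : Type*} {p v : Config V} :
    v ∈ LinearMap.range (rigidVelocity p) ↔ RigidOn p univ v := by
  simp only [LinearMap.mem_range, Prod.exists, RigidOn, mem_univ, forall_const]
  refine exists_congr fun a => exists_congr fun b => ⟨?_, fun h => ?_⟩
  · rintro rfl i; rfl
  · ext1 i; exact (h i).symm

/-- The relative velocity of two distinct points determines the angular velocity, so the three
parameters act faithfully. -/
theorem finrank_range_rigidVelocity {V : Type*} {p : Config V} {i j : V} (hij : p i ≠ p j) :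
    Module.finrank ℝ (LinearMap.range (rigidVelocity p)) = 3 := by
  rw [LinearMap.finrank_range_of_inj]
  · simp
  · rw [← LinearMap.ker_eq_bot, LinearMap.ker_eq_bot']
    rintro ⟨a, b⟩ h
    have hl : ∀ l, a • quarterTurn (p l) + b = 0 := fun l =>
      congrArg (fun x : Config V => x l) h
    have hsub : a • quarterTurn (p i - p j) = 0 := by
      rw [map_sub]
      linear_combination (norm := module) hl i - hl j
    have ha : a = 0 := (smul_eq_zero.1 hsub).resolve_right fun h0 =>
      hij (sub_eq_zero.1 (quarterTurn_eq_zero.1 h0))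
    have hb := hl i
    rw [ha, zero_smul, zero_add] at hb
    rw [ha, hb]; rfl

theorem isSymmetric_hessian_potential
    (hu : ∀ e ∈ G.edgeSet, ContDiffOn ℝ 1 (fun d => u e d (dbar e)) (Ioi 0))
    {q : Config V} (hq : q ∈ configSpace G) :
    (hessian (potential G u dbar) q).IsSymmetric := fun v w => by
  rw [real_inner_comm _ v, inner_hessian_potential hu hq, inner_hessian_potential hu hq,
    stiffnessForm_symm]

/-- At a critical point the kernel contains the rigid motions, a space of dimension three because
some edge has distinct endpoints. Multiplicity three therefore means equality. -/
theorem count_zero_hessianEigenvalues_potential_iff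
    (hu : ∀ e ∈ G.edgeSet, ContDiffOn ℝ 1 (fun d => u e d (dbar e)) (Ioi 0))
    {q : Config V} (hq : q ∈ configSpace G) (hcrit : IsCriticalPt (potential G u dbar) q)
    (hne : G.edgeSet.Nonempty) :
    (hessianEigenvalues (potential G u dbar) q).count 0 = 3 ↔
      ∀ v, (∀ w, stiffnessForm q (controlStress u dbar q) (controlStiffness u dbar q)
        G.edgeSet v w = 0) → RigidOn q univ v := by
  have hker : ∀ v, v ∈ LinearMap.ker (hessian (potential G u dbar) q) ↔
      ∀ w, stiffnessForm q (controlStress u dbar q) (controlStiffness u dbar q)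
        G.edgeSet v w = 0 := fun v => by
    simp only [← inner_hessian_potential hu hq, LinearMap.mem_ker]
    exact ⟨fun h w => by rw [h, inner_zero_left], fun h => inner_self_eq_zero.1 (h _)⟩
  have hle : LinearMap.range (rigidVelocity q) ≤
      LinearMap.ker (hessian (potential G u dbar) q) := fun v hv => (hker v).2 fun w =>
    ((mem_range_rigidVelocity.1 hv).mono (subset_univ _)).stiffnessForm_eq_zero
      ((isCriticalPt_potential_iff hu hq).1 hcrit) w
  obtain ⟨e, he⟩ := hne
  induction e with | _ i j =>
  have hrank := finrank_range_rigidVelocity (hq i j he)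
  rw [hessianEigenvalues, (isSymmetric_hessian_potential hu hq).count_roots_charpoly,
    Module.End.eigenspace_zero]
  constructor
  · intro h v hv
    rw [← mem_range_rigidVelocity, Submodule.eq_of_le_of_finrank_eq hle (hrank.trans h.symm)]
    exact (hker v).2 hv
  · intro h
    rw [← hrank, le_antisymm hle fun v hv => mem_range_rigidVelocity.2 (h v ((hker v).1 hv))]

theorem hessianEigenvalues_potential_pos_iff
    (hu : ∀ e ∈ G.edgeSet, ContDiffOn ℝ 1 (fun d => u e d (dbar e)) (Ioi 0))
    {q : Config V} (hq : q ∈ configSpace G) :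
    (∀ c ∈ hessianEigenvalues (potential G u dbar) q, c ≠ 0 → 0 < c) ↔
      ∀ v, 0 ≤ stiffnessForm q (controlStress u dbar q) (controlStiffness u dbar q)
        G.edgeSet v v := by
  simp only [← inner_hessian_potential hu hq]
  exact (isSymmetric_hessian_potential hu hq).roots_charpoly_pos_iff

end Criteria

/-! ### Transfer between a piece and the ambient graph -/

section Parts

variable {V : Type*} {u : Sym2 V → ℝ → ℝ → ℝ} {dbar : Sym2 V → ℝ}

/-- `fromEdgeSet` discards loops, which is why `C` must contain none. -/
theorem mem_edgeSet_partGraph {C : Set (Sym2 V)} (hC : ∀ e ∈ C, ¬ e.IsDiag)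
    {e : Sym2 (incidentVerts C)} : e ∈ (partGraph C).edgeSet ↔ e.map Subtype.val ∈ C := by
  induction e with | _ i j =>
  simp only [partGraph, SimpleGraph.mem_edgeSet, SimpleGraph.comap_adj,
    SimpleGraph.fromEdgeSet_adj, Sym2.map_mk, Function.Embedding.subtype_apply]
  exact ⟨fun h => h.1, fun h => ⟨h, fun h0 => hC _ h h0⟩⟩

theorem image_edgeSet_partGraph {C : Set (Sym2 V)} (hC : ∀ e ∈ C, ¬ e.IsDiag) :
    Sym2.map Subtype.val '' (partGraph C).edgeSet = C := by
  ext e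
  constructor
  · rintro ⟨e, he, rfl⟩
    exact (mem_edgeSet_partGraph hC).1 he
  · intro he
    induction e with | _ i j =>
    exact ⟨s(⟨i, left_mem_incidentVerts he⟩, ⟨j, right_mem_incidentVerts he⟩),
      (mem_edgeSet_partGraph hC).2 he, rfl⟩

theorem finsum_mem_edgeSet_partGraph {C : Set (Sym2 V)} (hC : ∀ e ∈ C, ¬ e.IsDiag)
    (f : Sym2 V → ℝ) :
    ∑ᶠ e ∈ (partGraph C).edgeSet, f (e.map Subtype.val) = ∑ᶠ e ∈ C, f e := by
  conv_rhs => rw [← image_edgeSet_partGraph hC]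
  rw [finsum_mem_image (Sym2.map.injective Subtype.val_injective).injOn]

theorem edgeForm_partConfig [Fintype V] {C : Set (Sym2 V)} (e : Sym2 (incidentVerts C)) (v w : Config V) :
    edgeForm e (partConfig v C) (partConfig w C) = edgeForm (e.map Subtype.val) v w := by
  induction e with | _ i j => rfl

theorem pairDist_partConfig {C : Set (Sym2 V)} (e : Sym2 (incidentVerts C)) (v : Config V) :
    pairDist (partConfig v C) e = pairDist v (e.map Subtype.val) := by
  induction e with | _ i j => rfl

/-- This allows conditions on a piece to be quantified over configurations of all of `V`, where
different pieces can be compared. -/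
theorem partConfig_surjective (C : Set (Sym2 V)) :
    Function.Surjective fun v : Config V => partConfig v C := by
  classical
  intro v
  refine ⟨WithLp.toLp 2 fun i => if h : i ∈ incidentVerts C then v ⟨i, h⟩ else 0, ?_⟩
  ext1 i
  simp [partConfig]

theorem isStress_partConfig_iff [Fintype V] {C : Set (Sym2 V)} (hC : ∀ e ∈ C, ¬ e.IsDiag) (p : Config V)
    (ω : Sym2 V → ℝ) :
    IsStress (partConfig p C) (fun e => ω (e.map Subtype.val)) (partGraph C).edgeSet ↔
      IsStress p ω C := by
  rw [IsStress, (partConfig_surjective C).forall]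
  refine forall_congr' fun w => ?_
  simp only [edgeForm_partConfig]
  rw [finsum_mem_edgeSet_partGraph hC fun e => ω e * edgeForm e p w]

theorem stiffnessForm_partConfig [Fintype V] {C : Set (Sym2 V)} (hC : ∀ e ∈ C, ¬ e.IsDiag) (p : Config V)
    (ω c : Sym2 V → ℝ) (v w : Config V) :
    stiffnessForm (partConfig p C) (fun e => ω (e.map Subtype.val))
      (fun e => c (e.map Subtype.val)) (partGraph C).edgeSet (partConfig v C) (partConfig w C) =
      stiffnessForm p ω c C v w := by
  simp only [stiffnessForm, edgeForm_partConfig]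
  rw [finsum_mem_edgeSet_partGraph hC
    fun e => ω e * edgeForm e v w + c e * (edgeForm e p v * edgeForm e p w)]

theorem rigidOn_partConfig_iff {C : Set (Sym2 V)} {p v : Config V} :
    RigidOn (partConfig p C) univ (partConfig v C) ↔ RigidOn p (incidentVerts C) v :=
  exists_congr fun _ => exists_congr fun _ =>
    ⟨fun h i hi => h ⟨i, hi⟩ trivial, fun h i _ => h i i.2⟩

theorem controlStress_partConfig (C : Set (Sym2 V)) (p : Config V) :
    controlStress (fun e : Sym2 (incidentVerts C) => u (e.map Subtype.val))
      (fun e => dbar (e.map Subtype.val)) (partConfig p C) =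
      fun e => controlStress u dbar p (e.map Subtype.val) := by
  funext e; simp only [controlStress, pairDist_partConfig]

theorem controlStiffness_partConfig (C : Set (Sym2 V)) (p : Config V) :
    controlStiffness (fun e : Sym2 (incidentVerts C) => u (e.map Subtype.val))
      (fun e => dbar (e.map Subtype.val)) (partConfig p C) =
      fun e => controlStiffness u dbar p (e.map Subtype.val) := by
  funext e; simp only [controlStiffness, pairDist_partConfig]

variable {G : SimpleGraph V} {p : Config V} {C : Set (Sym2 V)}

theorem partConfig_mem_configSpace (hp : p ∈ configSpace G) (hC : C ⊆ G.edgeSet) :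
    partConfig p C ∈ configSpace (partGraph C) := fun i j hij =>
  hp i j (hC ((mem_edgeSet_partGraph fun _ he => G.not_isDiag_of_mem_edgeSet (hC he)).1
    ((partGraph C).mem_edgeSet.2 hij)))

theorem contDiffOn_part (hC : C ⊆ G.edgeSet)
    (hu : ∀ e ∈ G.edgeSet, ContDiffOn ℝ 1 (fun d => u e d (dbar e)) (Ioi 0)) :
    ∀ e ∈ (partGraph C).edgeSet, ContDiffOn ℝ 1
      (fun d => u (e.map Subtype.val) d (dbar (e.map Subtype.val))) (Ioi 0) := fun _ he =>
  hu _ (hC ((mem_edgeSet_partGraph fun _ he => G.not_isDiag_of_mem_edgeSet (hC he)).1 he))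

theorem isCriticalPt_partPotential_iff [Fintype V]
    (hu : ∀ e ∈ G.edgeSet, ContDiffOn ℝ 1 (fun d => u e d (dbar e)) (Ioi 0))
    (hp : p ∈ configSpace G) (hC : C ⊆ G.edgeSet) :
    IsCriticalPt (partPotential u dbar C) (partConfig p C) ↔
      IsStress p (controlStress u dbar p) C := by
  rw [partPotential, isCriticalPt_potential_iff (contDiffOn_part hC hu)
    (partConfig_mem_configSpace hp hC), controlStress_partConfig,
    isStress_partConfig_iff fun _ he => G.not_isDiag_of_mem_edgeSet (hC he)]

theorem count_zero_hessianEigenvalues_partPotential_iff [Fintype V]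
    (hu : ∀ e ∈ G.edgeSet, ContDiffOn ℝ 1 (fun d => u e d (dbar e)) (Ioi 0))
    (hp : p ∈ configSpace G) (hC : C ⊆ G.edgeSet) (hne : C.Nonempty)
    (hcrit : IsCriticalPt (partPotential u dbar C) (partConfig p C)) :
    (hessianEigenvalues (partPotential u dbar C) (partConfig p C)).count 0 = 3 ↔
      ∀ v, (∀ w, stiffnessForm p (controlStress u dbar p) (controlStiffness u dbar p) C v w = 0) →
        RigidOn p (incidentVerts C) v := by
  have hdiag : ∀ e ∈ C, ¬ e.IsDiag := fun _ he => G.not_isDiag_of_mem_edgeSet (hC he)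
  rw [partPotential, count_zero_hessianEigenvalues_potential_iff (contDiffOn_part hC hu)
    (partConfig_mem_configSpace hp hC) hcrit
    (by rw [← image_edgeSet_partGraph hdiag] at hne; exact hne.of_image),
    controlStress_partConfig, controlStiffness_partConfig, (partConfig_surjective C).forall]
  refine forall_congr' fun v => ?_
  rw [(partConfig_surjective C).forall, rigidOn_partConfig_iff]
  simp only [stiffnessForm_partConfig hdiag]

theorem hessianEigenvalues_partPotential_pos_iff [Fintype V]
    (hu : ∀ e ∈ G.edgeSet, ContDiffOn ℝ 1 (fun d => u e d (dbar e)) (Ioi 0))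
    (hp : p ∈ configSpace G) (hC : C ⊆ G.edgeSet) :
    (∀ c ∈ hessianEigenvalues (partPotential u dbar C) (partConfig p C), c ≠ 0 → 0 < c) ↔
      ∀ v, 0 ≤ stiffnessForm p (controlStress u dbar p) (controlStiffness u dbar p) C v v := by
  have hdiag : ∀ e ∈ C, ¬ e.IsDiag := fun _ he => G.not_isDiag_of_mem_edgeSet (hC he)
  rw [partPotential, hessianEigenvalues_potential_pos_iff (contDiffOn_part hC hu)
    (partConfig_mem_configSpace hp hC), controlStress_partConfig, controlStiffness_partConfig,
    (partConfig_surjective C).forall]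
  simp only [stiffnessForm_partConfig hdiag]

end Parts

/-! ### Block decomposition of the second variation -/

section Splitting

variable {V : Type*} [Fintype V] {p : Config V} {W : Set V} {E : Set (Sym2 V)}
  {P : Set (Set (Sym2 V))} {ω c : Sym2 V → ℝ}

theorem IndepPartitionStage.nonempty {V : Type*} {p : Config V} {W : Set V} {E : Set (Sym2 V)}
    {P : Set (Set (Sym2 V))} (h : IndepPartitionStage p W E P) :
    E.Nonempty ∧ ∀ C ∈ P, C.Nonempty := by
  induction h with
  | init a b hab => simp
  | @aligned W E P h i j k C hC hij hk hcol ih =>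
    refine ⟨ih.1.inl, ?_⟩
    rintro D (rfl | hD)
    · exact (ih.2 C hC).inl
    · exact ih.2 D hD.1
  | @notAligned W E P h i j k hij hk hcol ih =>
    refine ⟨ih.1.inl, ?_⟩
    rintro D (hD | rfl | rfl)
    · exact ih.2 D hD
    · exact singleton_nonempty _
    · exact singleton_nonempty _

theorem stiffnessForm_sub_left (C : Set (Sym2 V)) (v v' w : Config V) :
    stiffnessForm p ω c C (v - v') w = stiffnessForm p ω c C v w - stiffnessForm p ω c C v' w := by
  rw [stiffnessForm, stiffnessForm, stiffnessForm, ← finsum_mem_sub_distrib _ _ (toFinite _)]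
  refine finsum_mem_congr rfl fun e _ => ?_
  rw [map_sub, map_sub, sub_apply]
  ring

theorem stiffnessForm_congr_left {C : Set (Sym2 V)} {v v' : Config V} (hω : IsStress p ω C)
    (h : RigidOn p (incidentVerts C) (v - v')) (w : Config V) :
    stiffnessForm p ω c C v w = stiffnessForm p ω c C v' w := by
  rw [← sub_eq_zero, ← stiffnessForm_sub_left, h.stiffnessForm_eq_zero hω]

theorem IndepPartitionStage.stiffnessForm_eq_finsum (h : IndepPartitionStage p W E P)
    (v w : Config V) : stiffnessForm p ω c E v w = ∑ᶠ C ∈ P, stiffnessForm p ω c C v w := by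
  rw [← h.sUnion_eq]
  exact finsum_mem_sUnion h.pairwiseDisjoint (toFinite _) fun _ _ => toFinite _

/-- Every deformation of a piece extends to a global one on which only this piece contributes to
the second variation. -/
theorem IndepPartitionStage.exists_extension (h : IndepPartitionStage p W E P)
    (hω : ∀ C ∈ P, IsStress p ω C) {C : Set (Sym2 V)} (hC : C ∈ P) (v : Config V) :
    ∃ v', RigidOn p (incidentVerts C) (v' - v) ∧
      ∀ w, stiffnessForm p ω c E v' w = stiffnessForm p ω c C v w := by
  classical
  -- Prescribe `v` on `C` and rest on all other pieces; the rigid corrections are invisible to the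
  -- forms.
  obtain ⟨v', hv'⟩ := h.exists_glue fun D => if D = C then v else 0
  have hvC : RigidOn p (incidentVerts C) (v' - v) := by simpa using hv' C hC
  refine ⟨v', hvC, fun w => ?_⟩
  have hP : P = insert C (P \ {C}) := by rw [insert_sdiff_singleton, insert_eq_of_mem hC]
  rw [h.stiffnessForm_eq_finsum, hP, finsum_mem_insert _ (by simp) (toFinite _),
    stiffnessForm_congr_left (hω C hC) hvC, finsum_mem_congr rfl (g := fun _ => (0 : ℝ)),
    finsum_mem_zero, add_zero]
  intro D hD
  have hvD := hv' D hD.1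
  rw [if_neg (by simpa using hD.2), sub_zero] at hvD
  exact hvD.stiffnessForm_eq_zero (hω D hD.1) w

/-- A kernel vector of a piece extends to a global kernel vector. Conversely, testing a global
kernel vector against extensions from one piece shows that it lies in the kernel of that piece. -/
theorem IndepPartitionStage.forall_ker_rigidOn_iff (h : IndepPartitionStage p W E P)
    (hp : ∀ i j, s(i, j) ∈ E → p i ≠ p j) (hω : ∀ C ∈ P, IsStress p ω C) :
    (∀ v, (∀ w, stiffnessForm p ω c E v w = 0) → RigidOn p W v) ↔
      ∀ C ∈ P, ∀ v, (∀ w, stiffnessForm p ω c C v w = 0) → RigidOn p (incidentVerts C) v := by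
  constructor
  · intro H C hC v hv
    obtain ⟨v', hrig, hform⟩ := h.exists_extension (c := c) hω hC v
    have hv' := H v' fun w => (hform w).trans (hv w)
    have := (hv'.mono ((incidentVerts_mono (h.incidentVerts_subset.2 C hC)).trans
      h.incidentVerts_subset.1)).sub hrig
    rwa [sub_sub_cancel] at this
  · intro H v hv
    refine h.rigidOn hp fun C hC => H C hC v fun w => ?_
    obtain ⟨w', -, hform⟩ := h.exists_extension (c := c) hω hC w
    rw [stiffnessForm_symm, ← hform, stiffnessForm_symm, hv]

/-- The global form at an extension of `v` equals the form of the piece at `v`; in the other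
direction, nonnegative forms add up. -/
theorem IndepPartitionStage.forall_stiffnessForm_nonneg_iff (h : IndepPartitionStage p W E P)
    (hω : ∀ C ∈ P, IsStress p ω C) :
    (∀ v, 0 ≤ stiffnessForm p ω c E v v) ↔ ∀ C ∈ P, ∀ v, 0 ≤ stiffnessForm p ω c C v v := by
  constructor
  · intro H C hC v
    obtain ⟨v', hrig, hform⟩ := h.exists_extension (c := c) hω hC v
    have := H v'
    rwa [hform, stiffnessForm_symm, stiffnessForm_congr_left (hω C hC) hrig] at this
  · intro H v
    rw [h.stiffnessForm_eq_finsum]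
    exact finsum_nonneg fun C => finsum_nonneg fun hC => H C hC v

end Splitting

end

/-! ### The splitting theorem -/

theorem mainTheorem5 {V : Type*} [Fintype V] (G : SimpleGraph V) (hG : IsTriangulatedLaman G)
    (u : Sym2 V → ℝ → ℝ → ℝ) (dbar : Sym2 V → ℝ)
    (hu : ∀ e ∈ G.edgeSet, ContDiffOn ℝ 1 (fun d => u e d (dbar e)) (Set.Ioi 0))
    (p : Config V) (hp : p ∈ configSpace G) (hcrit : IsCriticalPt (potential G u dbar) p)
    (P : Set (Set (Sym2 V))) (hP : IsIndependentPartition G p P) :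
    (∀ E ∈ P, IsCriticalOrbit (partPotential u dbar E) (orbitSE2 (partConfig p E))) ∧
    (IsNondegenerateOrbit (potential G u dbar) (orbitSE2 p) ↔
      ∀ E ∈ P, IsNondegenerateOrbit (partPotential u dbar E) (orbitSE2 (partConfig p E))) ∧
    (IsExpStableOrbit (potential G u dbar) (orbitSE2 p) ↔
      ∀ E ∈ P, IsExpStableOrbit (partPotential u dbar E) (orbitSE2 (partConfig p E))) := by
  have hstage : IndepPartitionStage p univ G.edgeSet P := hP
  have hsub := hstage.incidentVerts_subset.2
  have hpE : ∀ i j, s(i, j) ∈ G.edgeSet → p i ≠ p j := hp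
  have hω : ∀ C ∈ P, IsStress p (controlStress u dbar p) C :=
    hstage.isStress hpE ((isCriticalPt_potential_iff hu hp).1 hcrit)
  have hcritC : ∀ C ∈ P, IsCriticalPt (partPotential u dbar C) (partConfig p C) := fun C hC =>
    (isCriticalPt_partPotential_iff hu hp (hsub C hC)).2 (hω C hC)
  have hnd : IsNondegenerateOrbit (potential G u dbar) (orbitSE2 p) ↔
      ∀ E ∈ P, IsNondegenerateOrbit (partPotential u dbar E) (orbitSE2 (partConfig p E)) := by
    rw [isNondegenerateOrbit_potential_iff hcrit,
      count_zero_hessianEigenvalues_potential_iff hu hp hcrit hstage.nonempty.1,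
      hstage.forall_ker_rigidOn_iff hpE hω]
    refine forall₂_congr fun C hC => ?_
    rw [← count_zero_hessianEigenvalues_partPotential_iff hu hp (hsub C hC)
      (hstage.nonempty.2 C hC) (hcritC C hC)]
    exact (isNondegenerateOrbit_potential_iff (hcritC C hC)).symm
  refine ⟨fun C hC => isCriticalOrbit_potential_iff.2 (hcritC C hC), hnd, ?_⟩
  -- Given nondegeneracy, stability is semidefiniteness of the form, which splits over the pieces.
  rw [isExpStableOrbit_potential_iff, hnd, hessianEigenvalues_potential_pos_iff hu hp,
    hstage.forall_stiffnessForm_nonneg_iff hω, ← forall₂_and]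
  refine forall₂_congr fun C hC => ?_
  rw [← hessianEigenvalues_partPotential_pos_iff hu hp (hsub C hC)]
  exact isExpStableOrbit_potential_iff.symm
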